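/- Let $(\Omega,\mathcal F)$ be a measurable space with a measurable flow $(\theta_s)_{s\in\mathbb R^d}$, i.e. $(\omega,s)\mapsto\theta_s\omega$ is measurable, $\theta_0=\mathrm{id}$ and $\theta_s\circ\theta_t=\theta_{s+t}$, and let $\mathbb P$ be a probability measure on $\Omega$ that is invariant under every $\theta_s$. Let $\Phi,\Psi$ be stationary random measures on $\mathbb R^d$: measurable maps $\omega\mapsto\Phi_\omega,\Psi_\omega$ from $\Omega$ to the locally finite Borel measures on $\mathbb R^d$ with $\Phi_{\theta_s\omega}(B)=\Phi_\omega(B+s)$ and $\Psi_{\theta_s\omega}(B)=\Psi_\omega(B+s)$ for all $s$, $\omega$ and Borel sets $B$. Suppose that their intensities $\lambda_\Phi,\lambda_\Psi$, defined by $\mathbb E[\Phi(B)]=\lambda_\Phi\mathcal L_d(B)$ and $\mathbb E[\Psi(B)]=\lambda_\Psi\mathcal L_d(B)$ for all Borel sets $B$, where $\mathcal L_d$ is Lebesgue measure, are positive and finite. For locally finite Borel measures $\varphi,\psi$ on $\mathbb R^d$, a measurable function $f:\mathbb R^d\times\mathbb R^d\to[0,1]$ is a *constrained density* for $(\varphi,\psi)$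 if $\int f(x,\xi)\,\psi(d\xi)\le 1$ for all $x$ and $\int f(x,\xi)\,\varphi(dx)\le 1$ for all $\xi$. We say that $x_0$ *desires* $\xi_0$ if $f(x_0,\xi_0)<1$ and either $\int f(x_0,\xi)\,\psi(d\xi)\neq1$ or there is $\xi_1\in\mathbb R^d$ with $|x_0-\xi_1|>|x_0-\xi_0|$ and $f(x_0,\xi_1)>0$; and that $\xi_0$ *desires* $x_0$ if $f(x_0,\xi_0)<1$ and either $\int f(x,\xi_0)\,\varphi(dx)\neq1$ or there is $x_1\in\mathbb R^d$ with $|x_1-\xi_0|>|x_0-\xi_0|$ and $f(x_1,\xi_0)>0$. The density $f$ is *stable* if there is no $(x_0,\xi_0)\in\mathbb R^d\times\mathbb R^d$ such that $x_0$ desires $\xi_0$ and $\xi_0$ desires $x_0$. Suppose that for $\mathbb P$-almost every $\omega$ the pair $(\varphi,\psi)=(\Phi_\omega,\Psi_\omega)$ satisfies, with $S_r(x)$ the sphere of radius $r$ around $x$: - for $\varphi$-a.e. $x$ and every $r>0$ there is $s\in S_r(x)$ with $\psi(S_r(x)\setminus\{s\})=0$; - for $\psi$-a.e. $\xi$ and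 every $r>0$ there is $s\in S_r(\xi)$ with $\varphi(S_r(\xi)\setminus\{s\})=0$. Then for $\mathbb P$-almost every $\omega$, any two stable constrained densities for $(\Phi_\omega,\Psi_\omega)$ agree $(\Phi_\omega\otimes\Psi_\omega)$-almost everywhere. -/

import Mathlib

open MeasureTheory
open scoped NNReal ENNReal

namespace StableTransport

/-- `ℝ^d` with the Euclidean distance. -/
abbrev Space (d : ℕ) : Type := EuclideanSpace ℝ (Fin d)

section Random

variable {d : ℕ} {Ω : Type*} [MeasurableSpace Ω]

/-- `θ` is a measurable flow on `Ω`, indexed by `ℝ^d`. -/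
structure IsMeasurableFlow (θ : Space d → Ω → Ω) : Prop where
  measurable : Measurable fun p : Ω × Space d => θ p.2 p.1
  zero : ∀ ω, θ 0 ω = ω
  add : ∀ s t ω, θ s (θ t ω) = θ (s + t) ω

/-- The probability measure `P` is stationary: it is invariant under the flow. -/
def IsStationaryProb (θ : Space d → Ω → Ω) (P : Measure Ω) : Prop :=
  ∀ s, P.map (θ s) = P

/-- The natural flow on measures: `(shift s φ) B = φ (B + s)`. -/
noncomputable def shift (s : Space d) (φ : Measure (Space d)) : Measure (Space d) :=
  φ.map fun x => x - s

/-- `Φ` is a stationary random measure under `P`: `P` is a stationary measure, and `Φ` is a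
measurable and flow-adapted map into the locally finite measures. The σ-field on
`Measure (Space d)` is the one generated by the evaluations at Borel sets. -/
structure IsStationaryRandomMeasure (θ : Space d → Ω → Ω) (P : Measure Ω)
    (Φ : Ω → Measure (Space d)) : Prop where
  stationary : IsStationaryProb θ P
  locallyFinite : ∀ ω, IsLocallyFiniteMeasure (Φ ω)
  measurable : Measurable Φ
  flowAdapted : ∀ s ω, Φ (θ s ω) = shift s (Φ ω)

/-- `Φ` has intensity `c` under `P`: `E[Φ(B)] = c · Leb(B)` for every Borel set `B`. -/
def HasIntensity (P : Measure Ω) (Φ : Ω → Measure (Space d)) (c : ℝ≥0∞) : Prop :=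
  ∀ B : Set (Space d), MeasurableSet B → ∫⁻ ω, Φ ω B ∂P = c * volume B

end Random

section Deterministic

variable {d : ℕ}

/-- Sub-balancing density for `φ` (on sites `x`) and `ψ` (on centers `ξ`). -/
structure IsSubBalancing (φ ψ : Measure (Space d)) (f : Space d → Space d → ℝ≥0) : Prop where
  measurable : Measurable fun p : Space d × Space d => f p.1 p.2
  site_le : ∀ x, ∫⁻ ξ, (f x ξ : ℝ≥0∞) ∂ψ ≤ 1
  center_le : ∀ ξ, ∫⁻ x, (f x ξ : ℝ≥0∞) ∂φ ≤ 1

/-- Constrained density: sub-balancing and bounded by `1` everywhere. -/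
structure IsConstrained (φ ψ : Measure (Space d)) (f : Space d → Space d → ℝ≥0) : Prop
    extends IsSubBalancing φ ψ f where
  le_one : ∀ x ξ, f x ξ ≤ 1

/-- The site `x` is exhausted. -/
def Exhausted (ψ : Measure (Space d)) (f : Space d → Space d → ℝ≥0) (x : Space d) : Prop :=
  ∫⁻ ξ, (f x ξ : ℝ≥0∞) ∂ψ = 1

/-- The center `ξ` is sated. -/
def Sated (φ : Measure (Space d)) (f : Space d → Space d → ℝ≥0) (ξ : Space d) : Prop :=
  ∫⁻ x, (f x ξ : ℝ≥0∞) ∂φ = 1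

/-- The site `x₀` desires the center `ξ₀`. -/
def SiteDesires (ψ : Measure (Space d)) (f : Space d → Space d → ℝ≥0)
    (x₀ ξ₀ : Space d) : Prop :=
  f x₀ ξ₀ < 1 ∧ (¬ Exhausted ψ f x₀ ∨ ∃ ξ₁, dist x₀ ξ₀ < dist x₀ ξ₁ ∧ 0 < f x₀ ξ₁)

/-- The center `ξ₀` desires the site `x₀`. -/
def CenterDesires (φ : Measure (Space d)) (f : Space d → Space d → ℝ≥0)
    (x₀ ξ₀ : Space d) : Prop :=
  f x₀ ξ₀ < 1 ∧ (¬ Sated φ f ξ₀ ∨ ∃ x₁, dist x₀ ξ₀ < dist x₁ ξ₀ ∧ 0 < f x₁ ξ₀)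

/-- Stable constrained density: no `x₀` and `ξ₀` in `ℝ^d` desire each other. -/
structure IsStableConstrained (φ ψ : Measure (Space d)) (f : Space d → Space d → ℝ≥0) : Prop
    extends IsConstrained φ ψ f where
  stable : ∀ x₀ ξ₀, ¬ (SiteDesires ψ f x₀ ξ₀ ∧ CenterDesires φ f x₀ ξ₀)

/-- `μ` charges at most one point of every sphere of positive radius around `x`. -/
def SpheresOnePoint (μ : Measure (Space d)) (x : Space d) : Prop :=
  ∀ r : ℝ, 0 < r → ∃ s ∈ Metric.sphere x r, μ (Metric.sphere x r \ {s}) = 0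

/-- The uniqueness assumption on the pair `(φ, ψ)`. -/
def UniquenessAssumption (φ ψ : Measure (Space d)) : Prop :=
  (∀ᵐ x ∂φ, SpheresOnePoint ψ x) ∧ (∀ᵐ ξ ∂ψ, SpheresOnePoint φ ξ)

end Deterministic

end StableTransport

/-!
Run deferred acceptance, in which every point keeps its nearest offers up to total mass one, from
the two extreme starting points: all offers to the sites open, and all of them closed. When the
spheres around typical points carry at most one atom, a stable density is a fixed point of this
procedure, so its offers lie between the two limits. By the mass transport principle the mass
which a site sends within distance `r` in one limit has the same mean as the mass which a center
receives within distance `r`. Going from the sites to the centers and back shows that the two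
limits send equally much in the mean, hence almost surely from every site and within every radius.
So every stable density takes from the upper limit the nearest offers of mass one, and around a
site whose spheres carry at most one atom this choice is unique.
-/

namespace StableTransport

open Metric Set Filter Topology

section Balls

variable {E : Type*} [PseudoMetricSpace E] [MeasurableSpace E] {ν : Measure E} {x : E}
  {c : ℝ≥0∞}

theorem measure_ball_le_of_forall_lt {r : ℝ} (h : ∀ ρ < r, ν (closedBall x ρ) ≤ c) :
    ν (ball x r) ≤ c := by
  obtain ⟨u, hu, hur, hlim⟩ := exists_seq_strictMono_tendsto r
  have hball : ball x r = ⋃ n, closedBall x (u n) := by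
    refine (iUnion_subset fun n => closedBall_subset_ball (hur n)).antisymm' fun y hy => ?_
    obtain ⟨n, hn⟩ := (hlim.eventually (lt_mem_nhds hy)).exists
    exact mem_iUnion.2 ⟨n, hn.le⟩
  have hmono : Monotone fun n => closedBall x (u n) :=
    fun _ _ hij => closedBall_subset_closedBall (hu.monotone hij)
  rw [hball, hmono.measure_iUnion]
  exact iSup_le fun n => h _ (hur n)

theorem measure_univ_le_of_forall_closedBall_le (h : ∀ r, ν (closedBall x r) ≤ c) :
    ν univ ≤ c := by
  have hmono : Monotone fun n : ℕ => closedBall x (n : ℝ) :=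
    fun _ _ hij => closedBall_subset_closedBall (Nat.cast_le.2 hij)
  rw [← iUnion_closedBall_nat x, hmono.measure_iUnion]
  exact iSup_le fun n => h n

variable [BorelSpace E]

theorem le_measure_closedBall_of_forall_gt {r : ℝ} (hfin : ∀ ρ, ν (closedBall x ρ) ≠ ∞)
    (h : ∀ ρ > r, c ≤ ν (closedBall x ρ)) : c ≤ ν (closedBall x r) := by
  have hlim := tendsto_measure_biInter_gt (μ := ν) (s := closedBall x) (a := r)
    (fun _ _ => measurableSet_closedBall.nullMeasurableSet)
    (fun _ _ _ hij => closedBall_subset_closedBall hij) ⟨r + 1, by simp, hfin _⟩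
  rw [biInter_gt_closedBall] at hlim
  refine ge_of_tendsto hlim ?_
  filter_upwards [self_mem_nhdsWithin] with ρ hρ using h ρ hρ

theorem measure_ball_add_measure_sphere (ν : Measure E) (x : E) (r : ℝ) :
    ν (ball x r) + ν (sphere x r) = ν (closedBall x r) := by
  rw [← ball_union_sphere, measure_union sphere_disjoint_ball.symm isClosed_sphere.measurableSet]

theorem exists_isLeast_le_measure_closedBall (hfin : ∀ ρ, ν (closedBall x ρ) ≠ ∞) (hc : c ≠ 0)
    {r : ℝ} (hr : c ≤ ν (closedBall x r)) :
    ∃ r₀, IsLeast {ρ | c ≤ ν (closedBall x ρ)} r₀ := by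
  have hbdd : BddBelow {ρ | c ≤ ν (closedBall x ρ)} := by
    refine ⟨0, fun ρ hρ => le_of_not_gt fun hneg => hc ?_⟩
    rwa [mem_ofPred_eq, closedBall_eq_empty.2 hneg, measure_empty, nonpos_iff_eq_zero] at hρ
  refine ⟨sInf {ρ | c ≤ ν (closedBall x ρ)}, ?_, fun ρ hρ => csInf_le hbdd hρ⟩
  refine le_measure_closedBall_of_forall_gt hfin fun ρ hρ => ?_
  obtain ⟨a, ha, haρ⟩ := exists_lt_of_csInf_lt ⟨r, hr⟩ hρ
  exact ha.trans (measure_mono (closedBall_subset_closedBall haρ.le))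

theorem measure_sphere_eq_of_closedBall_eq {ν ν' : Measure E} (hfin : ∀ r, ν (closedBall x r) ≠ ∞)
    (h : ∀ r, ν (closedBall x r) = ν' (closedBall x r)) (r : ℝ) :
    ν (sphere x r) = ν' (sphere x r) := by
  have hball : ν (ball x r) = ν' (ball x r) :=
    le_antisymm
      (measure_ball_le_of_forall_lt fun ρ hρ =>
        (h ρ).trans_le (measure_mono (closedBall_subset_ball hρ)))
      (measure_ball_le_of_forall_lt fun ρ hρ =>
        (h ρ).symm.trans_le (measure_mono (closedBall_subset_ball hρ)))
  have hsum := measure_ball_add_measure_sphere ν x r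
  rw [h, ← measure_ball_add_measure_sphere ν' x r, ← hball] at hsum
  exact (ENNReal.add_right_inj
    (measure_ne_top_of_subset ball_subset_closedBall (hfin r))).1 hsum

end Balls

section Acceptance

variable {E : Type*} [PseudoMetricSpace E] [MeasurableSpace E]

/-- The proportion accepted at distance `r` from `x` when the offers `ν` are accepted in the order
of their distance to `x`, up to a total mass of one. Where `ν (sphere x r) = 0` the value is `0` or
`1`, according to whether `ν (ball x r)` has reached one. -/
noncomputable def share (ν : Measure E) (x : E) (r : ℝ) : ℝ≥0∞ :=
  min 1 ((1 - ν (ball x r)) / ν (sphere x r))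

theorem share_le_one (ν : Measure E) (x : E) (r : ℝ) : share ν x r ≤ 1 :=
  min_le_left _ _

theorem share_anti {ν ν' : Measure E} (h : ν ≤ ν') (x : E) (r : ℝ) :
    share ν' x r ≤ share ν x r :=
  min_le_min_left _ (ENNReal.div_le_div (tsub_le_tsub_left (h _) _) (h _))

theorem share_of_one_le_ball {ν : Measure E} {x : E} {r : ℝ} (h : 1 ≤ ν (ball x r)) :
    share ν x r = 0 := by
  rw [share, tsub_eq_zero_of_le h, ENNReal.zero_div, min_eq_right zero_le_one]

theorem share_of_closedBall_lt_one [BorelSpace E] {ν : Measure E} {x : E} {r : ℝ}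
    (h : ν (closedBall x r) < 1) : share ν x r = 1 := by
  have hball : ν (ball x r) < 1 := (measure_mono ball_subset_closedBall).trans_lt h
  have hsphere : ν (sphere x r) ≠ ∞ :=
    ((measure_mono sphere_subset_closedBall).trans_lt (h.trans ENNReal.one_lt_top)).ne
  refine min_eq_left ((ENNReal.le_div_iff_mul_le (.inr (tsub_pos_of_lt hball).ne')
    (.inl hsphere)).2 ?_)
  rw [one_mul]
  refine ENNReal.le_sub_of_add_le_left hball.ne_top ?_
  exact (measure_ball_add_measure_sphere ν x r).trans_le h.le

theorem measure_sphere_mul_share [BorelSpace E] {ν : Measure E} {x : E} {r : ℝ}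
    (hfin : ν (closedBall x r) ≠ ∞) (h : 1 ≤ ν (closedBall x r)) :
    ν (sphere x r) * share ν x r = 1 - ν (ball x r) := by
  rw [← measure_ball_add_measure_sphere] at h
  have hle : 1 - ν (ball x r) ≤ ν (sphere x r) := tsub_le_iff_left.2 h
  have hsphere : ν (sphere x r) ≠ ∞ := measure_ne_top_of_subset sphere_subset_closedBall hfin
  rw [share, min_eq_right (ENNReal.div_le_of_le_mul (by rwa [one_mul]))]
  exact ENNReal.mul_div_cancel' (fun h0 => le_zero_iff.1 (h0 ▸ hle)) fun htop => absurd htop hsphere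

/-- The part of the offers `w` that `x` accepts. -/
noncomputable def accept (μ : Measure E) (x : E) (w : E → ℝ≥0∞) (y : E) : ℝ≥0∞ :=
  w y * share (μ.withDensity w) x (dist y x)

/-- The part of the offers `w` that `x` rejects. -/
noncomputable def reject (μ : Measure E) (x : E) (w : E → ℝ≥0∞) (y : E) : ℝ≥0∞ :=
  w y * (1 - share (μ.withDensity w) x (dist y x))

theorem accept_add_reject (μ : Measure E) (x : E) (w : E → ℝ≥0∞) (y : E) :
    accept μ x w y + reject μ x w y = w y := by
  rw [accept, reject, ← mul_add, add_tsub_cancel_of_le (share_le_one _ _ _), mul_one]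

theorem accept_le (μ : Measure E) (x : E) (w : E → ℝ≥0∞) (y : E) : accept μ x w y ≤ w y :=
  le_self_add.trans_eq (accept_add_reject μ x w y)

theorem reject_le (μ : Measure E) (x : E) (w : E → ℝ≥0∞) (y : E) : reject μ x w y ≤ w y :=
  le_add_self.trans_eq (accept_add_reject μ x w y)

theorem reject_mono {μ : Measure E} {x : E} {w w' : E → ℝ≥0∞} (h : w ≤ᵐ[μ] w') {y : E}
    (hy : w y ≤ w' y) : reject μ x w y ≤ reject μ x w' y :=
  mul_le_mul' hy (tsub_le_tsub_left (share_anti (withDensity_mono h) _ _) _)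

theorem setLIntegral_accept {μ : Measure E} {x : E} {w : E → ℝ≥0∞} (hw : Measurable w)
    {A : Set E} (hA : MeasurableSet A) {c : ℝ≥0∞}
    (h : ∀ y ∈ A, share (μ.withDensity w) x (dist y x) = c) :
    ∫⁻ y in A, accept μ x w y ∂μ = μ.withDensity w A * c := by
  rw [withDensity_apply _ hA, ← lintegral_mul_const _ hw]
  exact setLIntegral_congr_fun hA fun y hy => by rw [accept, h y hy]

end Acceptance

section GreedyChoice

variable {E : Type*} [PseudoMetricSpace E] [MeasurableSpace E] {μ : Measure E} {x : E}

/-- The mass of the offers `w` within distance `r` of `x`, truncated at one. -/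
noncomputable def cappedMass (μ : Measure E) (w : E → ℝ≥0∞) (x : E) (r : ℝ) : ℝ≥0∞ :=
  min 1 (∫⁻ y in closedBall x r, w y ∂μ)

theorem cappedMass_mono {w w' : E → ℝ≥0∞} (h : w ≤ᵐ[μ] w') (x : E) (r : ℝ) :
    cappedMass μ w x r ≤ cappedMass μ w' x r :=
  min_le_min_left _ (lintegral_mono_ae (ae_restrict_of_ae h))

/-- `f` is a choice of mass at most one out of the offers `w` in which `x` takes the nearest offers
first. How an offer is split among the points of one sphere around `x` is left open. -/
structure IsGreedyChoice (μ : Measure E) (x : E) (w f : E → ℝ≥0∞) : Prop where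
  le : f ≤ᵐ[μ] w
  setLIntegral_closedBall : ∀ r, ∫⁻ y in closedBall x r, f y ∂μ = cappedMass μ w x r

/-- `f` has mass less than one within the distance from `x` to `y`, so that `x` accepts all that `y`
offers if `f` is a greedy choice. -/
def HasRoom (μ : Measure E) (x : E) (f : E → ℝ≥0∞) (y : E) : Prop :=
  ∫⁻ z in closedBall x (dist y x), f z ∂μ < 1

theorem IsGreedyChoice.setLIntegral_closedBall_le_one {w f : E → ℝ≥0∞}
    (h : IsGreedyChoice μ x w f) (r : ℝ) : ∫⁻ y in closedBall x r, f y ∂μ ≤ 1 :=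
  (h.setLIntegral_closedBall r).trans_le (min_le_left _ _)

theorem IsGreedyChoice.of_tendsto {w f : ℕ → E → ℝ≥0∞} {w' f' b : E → ℝ≥0∞}
    (h : ∀ n, IsGreedyChoice μ x (w n) (f n)) (hw : ∀ n, Measurable (w n))
    (hf : ∀ n, Measurable (f n)) (hwb : ∀ n, w n ≤ᵐ[μ] b)
    (hb : ∀ r, ∫⁻ y in closedBall x r, b y ∂μ ≠ ∞)
    (hwlim : ∀ y, Tendsto (fun n => w n y) atTop (𝓝 (w' y)))
    (hflim : ∀ y, Tendsto (fun n => f n y) atTop (𝓝 (f' y))) :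
    IsGreedyChoice μ x w' f' := by
  refine ⟨?_, fun r => ?_⟩
  · filter_upwards [ae_all_iff.2 fun n => (h n).le] with y hy
    exact le_of_tendsto_of_tendsto' (hflim y) (hwlim y) hy
  have hmass {g : ℕ → E → ℝ≥0∞} {g' : E → ℝ≥0∞} (hg : ∀ n, Measurable (g n))
      (hgb : ∀ n, g n ≤ᵐ[μ] b) (hlim : ∀ y, Tendsto (fun n => g n y) atTop (𝓝 (g' y))) :
      Tendsto (fun n => ∫⁻ y in closedBall x r, g n y ∂μ) atTop
        (𝓝 (∫⁻ y in closedBall x r, g' y ∂μ)) :=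
    tendsto_lintegral_of_dominated_convergence b hg (fun n => ae_restrict_of_ae (hgb n)) (hb r)
      (.of_forall hlim)
  refine tendsto_nhds_unique (hmass hf (fun n => (h n).le.trans (hwb n)) hflim) ?_
  simp only [(h _).setLIntegral_closedBall r]
  exact tendsto_const_nhds.min (hmass hw hwb hwlim)

variable [BorelSpace E]

theorem isGreedyChoice_accept {w : E → ℝ≥0∞} (hw : Measurable w)
    (hfin : ∀ r, ∫⁻ y in closedBall x r, w y ∂μ ≠ ∞) :
    IsGreedyChoice μ x w (accept μ x w) := by
  refine ⟨.of_forall (accept_le μ x w), fun r => ?_⟩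
  simp only [cappedMass, ← withDensity_apply w measurableSet_closedBall] at hfin ⊢
  let ν := μ.withDensity w
  rcases lt_or_ge (ν (closedBall x r)) 1 with hr | hr
  · rw [min_eq_right hr.le, setLIntegral_accept hw measurableSet_closedBall (c := 1), mul_one]
    exact fun y hy => share_of_closedBall_lt_one
      ((measure_mono (closedBall_subset_closedBall hy)).trans_lt hr)
  obtain ⟨r₀, hr₀, hmin⟩ := exists_isLeast_le_measure_closedBall hfin one_ne_zero hr
  have hlt : ∀ ρ < r₀, ν (closedBall x ρ) < 1 := fun ρ hρ => not_le.1 fun h => hρ.not_ge (hmin h)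
  have hball : ν (ball x r₀) ≤ 1 := measure_ball_le_of_forall_lt fun ρ hρ => (hlt ρ hρ).le
  have hin : ∫⁻ y in ball x r₀, accept μ x w y ∂μ = ν (ball x r₀) := by
    rw [setLIntegral_accept hw measurableSet_ball (c := 1), mul_one]
    exact fun y hy => share_of_closedBall_lt_one (hlt _ hy)
  have hon : ∫⁻ y in sphere x r₀, accept μ x w y ∂μ = 1 - ν (ball x r₀) := by
    rw [setLIntegral_accept hw isClosed_sphere.measurableSet fun y hy => by rw [mem_sphere.1 hy]]
    exact measure_sphere_mul_share (hfin r₀) hr₀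
  have hout : ∫⁻ y in closedBall x r \ closedBall x r₀, accept μ x w y ∂μ = 0 := by
    rw [setLIntegral_accept hw (measurableSet_closedBall.diff measurableSet_closedBall) (c := 0),
      mul_zero]
    exact fun y hy => share_of_one_le_ball
      (hr₀.trans (measure_mono (closedBall_subset_ball (not_le.1 hy.2))))
  rw [min_eq_left hr, ← union_sdiff_cancel (closedBall_subset_closedBall (x := x) (hmin hr)),
    lintegral_union (measurableSet_closedBall.diff measurableSet_closedBall) disjoint_sdiff_right,
    ← ball_union_sphere, lintegral_union isClosed_sphere.measurableSet sphere_disjoint_ball.symm,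
    ball_union_sphere, hin, hon, hout, add_zero, add_tsub_cancel_of_le hball]

theorem isGreedyChoice_of_eq_of_hasRoom {w f : E → ℝ≥0∞} (hf : ∫⁻ y, f y ∂μ ≤ 1) (hle : f ≤ w)
    (heq : ∀ y, HasRoom μ x f y → f y = w y) :
    IsGreedyChoice μ x w f := by
  refine ⟨.of_forall hle, fun r => ?_⟩
  rcases ((setLIntegral_le_lintegral _ _).trans hf).lt_or_eq with hlt | h1
  · have hsame : ∫⁻ y in closedBall x r, f y ∂μ = ∫⁻ y in closedBall x r, w y ∂μ :=
      setLIntegral_congr_fun measurableSet_closedBall fun y hy =>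
        heq y ((lintegral_mono_set (closedBall_subset_closedBall hy)).trans_lt hlt)
    rw [cappedMass, ← hsame, min_eq_right hlt.le]
  · rw [cappedMass, h1, min_eq_left (h1.symm.trans_le (lintegral_mono hle))]

theorem IsGreedyChoice.ae_eq_of_hasRoom {w f : E → ℝ≥0∞} (h : IsGreedyChoice μ x w f)
    (hw : Measurable w) : ∀ᵐ y ∂μ, HasRoom μ x f y → f y = w y := by
  have hfin (r : ℝ) : ∫⁻ y in closedBall x r, f y ∂μ ≠ ∞ :=
    ((h.setLIntegral_closedBall_le_one r).trans_lt ENNReal.one_lt_top).ne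
  have hball (q : ℚ) : ∀ᵐ y ∂μ, y ∈ closedBall x q →
      ∫⁻ z in closedBall x q, f z ∂μ < 1 → f y = w y := by
    by_cases hq : ∫⁻ z in closedBall x q, f z ∂μ < 1
    · have hmass := h.setLIntegral_closedBall q
      rw [hmass, cappedMass, min_lt_iff, or_iff_right (lt_irrefl _)] at hq
      rw [cappedMass, min_eq_right hq.le] at hmass
      have hae := ae_eq_of_ae_le_of_lintegral_le (ae_restrict_of_ae h.le) (hfin q)
        hw.aemeasurable hmass.ge
      filter_upwards [(ae_restrict_iff' measurableSet_closedBall).1 hae] with y hy hmem _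
      exact hy hmem
    · exact .of_forall fun y _ hlt => absurd hlt hq
  filter_upwards [ae_all_iff.2 hball] with y hy hroom
  obtain ⟨ρ, hρ, hρlt⟩ : ∃ ρ > dist y x, ∫⁻ z in closedBall x ρ, f z ∂μ < 1 := by
    rw [HasRoom] at hroom
    contrapose! hroom with hlt
    simp only [← withDensity_apply f measurableSet_closedBall] at hlt hfin ⊢
    exact le_measure_closedBall_of_forall_gt hfin hlt
  obtain ⟨q, hyq, hqρ⟩ := exists_rat_btwn hρ
  exact hy q hyq.le ((lintegral_mono_set (closedBall_subset_closedBall hqρ.le)).trans_lt hρlt)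

theorem ae_eq_zero_of_one_le_setLIntegral_closedBall {f : E → ℝ≥0∞} (hf : Measurable f)
    (h1 : ∀ r, ∫⁻ y in closedBall x r, f y ∂μ ≤ 1) {r : ℝ}
    (hr : 1 ≤ ∫⁻ y in closedBall x r, f y ∂μ) : ∀ᵐ y ∂μ, r < dist y x → f y = 0 := by
  simp only [← withDensity_apply f measurableSet_closedBall] at h1 hr
  have hnull : μ.withDensity f (closedBall x r)ᶜ = 0 := by
    rw [measure_compl measurableSet_closedBall ((h1 r).trans_lt ENNReal.one_lt_top).ne]
    exact tsub_eq_zero_of_le ((measure_univ_le_of_forall_closedBall_le h1).trans hr)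
  rw [withDensity_apply _ measurableSet_closedBall.compl, lintegral_eq_zero_iff hf] at hnull
  filter_upwards [(ae_restrict_iff' measurableSet_closedBall.compl).1 hnull] with y hy hlt
    using hy (not_le.2 hlt)

end GreedyChoice

section Uniqueness

variable {E : Type*} [MetricSpace E] [MeasurableSpace E] [BorelSpace E] {μ : Measure E} {x : E}

theorem ae_eq_on_sphere {f g : E → ℝ≥0∞} (hfin : ∀ r, μ (closedBall x r) ≠ ∞) {r : ℝ}
    (hone : ∃ s ∈ sphere x r, μ (sphere x r \ {s}) = 0)
    (heq : ∫⁻ y in sphere x r, f y ∂μ = ∫⁻ y in sphere x r, g y ∂μ) :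
    ∀ᵐ y ∂μ, dist y x = r → f y = g y := by
  obtain ⟨s, hs, hnull⟩ := hone
  have hsphere : sphere x r =ᵐ[μ] ({s} : Set E) := by
    rw [← union_eq_self_of_subset_right (singleton_subset_iff.2 hs), ← sdiff_union_self]
    exact union_ae_eq_right_of_ae_eq_empty (ae_eq_empty.2 hnull)
  rw [setLIntegral_congr hsphere, setLIntegral_congr hsphere, lintegral_singleton,
    lintegral_singleton] at heq
  by_cases hatom : μ {s} = 0
  · filter_upwards [measure_eq_zero_iff_ae_notMem.1 hnull,
      measure_eq_zero_iff_ae_notMem.1 hatom] with y hy hys hyr using absurd ⟨hyr, hys⟩ hy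
  · have hs_fin : μ {s} ≠ ∞ :=
      measure_ne_top_of_subset (singleton_subset_iff.2 (sphere_subset_closedBall hs)) (hfin r)
    have hfg : f s = g s := (ENNReal.mul_left_inj hatom hs_fin).1 heq
    filter_upwards [measure_eq_zero_iff_ae_notMem.1 hnull] with y hy hyr
    obtain rfl : y = s := by_contra fun hne => hy ⟨hyr, hne⟩
    exact hfg

theorem ae_eq_of_not_hasRoom {f g : E → ℝ≥0∞} (hf : Measurable f)
    (hg : Measurable g) (hfin : ∀ r, μ (closedBall x r) ≠ ∞)
    (hone : ∀ r : ℝ, 0 < r → ∃ s ∈ sphere x r, μ (sphere x r \ {s}) = 0)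
    (h1 : ∀ r, ∫⁻ y in closedBall x r, f y ∂μ ≤ 1)
    (heq : ∀ r, ∫⁻ y in closedBall x r, f y ∂μ = ∫⁻ y in closedBall x r, g y ∂μ) :
    ∀ᵐ y ∂μ, ¬ HasRoom μ x f y → f y = g y := by
  have hffin (r : ℝ) : ∫⁻ y in closedBall x r, f y ∂μ ≠ ∞ :=
    ((h1 r).trans_lt ENNReal.one_lt_top).ne
  by_cases hex : ∃ r, 1 ≤ ∫⁻ y in closedBall x r, f y ∂μ
  swap
  · exact .of_forall fun y hy => absurd ⟨_, not_lt.1 hy⟩ hex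
  obtain ⟨r₀, hr₀, hmin⟩ : ∃ r₀, IsLeast {ρ | 1 ≤ ∫⁻ y in closedBall x ρ, f y ∂μ} r₀ := by
    simp only [← withDensity_apply f measurableSet_closedBall] at hex hffin ⊢
    exact exists_isLeast_le_measure_closedBall hffin one_ne_zero hex.choose_spec
  have hpos : 0 ≤ r₀ := le_of_not_gt fun hneg => by
    simp [closedBall_eq_empty.2 hneg] at hr₀
  have hsphere : ∀ᵐ y ∂μ, dist y x = r₀ → f y = g y := by
    refine ae_eq_on_sphere hfin ?_ ?_
    · rcases hpos.eq_or_lt with rfl | hpos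
      · exact ⟨x, by simp⟩
      · exact hone r₀ hpos
    · simp only [← withDensity_apply _ measurableSet_closedBall,
        ← withDensity_apply _ isClosed_sphere.measurableSet] at heq hffin ⊢
      exact measure_sphere_eq_of_closedBall_eq hffin heq r₀
  filter_upwards [hsphere, ae_eq_zero_of_one_le_setLIntegral_closedBall hf h1 hr₀,
    ae_eq_zero_of_one_le_setLIntegral_closedBall hg (fun r => heq r ▸ h1 r)
      (le_of_le_of_eq hr₀ (heq r₀))]
    with y hy hfy hgy hroom
  rcases (hmin (not_lt.1 hroom)).eq_or_lt with heq₀ | hlt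
  · exact hy heq₀.symm
  · rw [hfy hlt, hgy hlt]

theorem IsGreedyChoice.ae_eq {w f g : E → ℝ≥0∞} (hfw : IsGreedyChoice μ x w f)
    (hgw : IsGreedyChoice μ x w g) (hf : Measurable f) (hg : Measurable g) (hw : Measurable w)
    (hfin : ∀ r, μ (closedBall x r) ≠ ∞)
    (hone : ∀ r : ℝ, 0 < r → ∃ s ∈ sphere x r, μ (sphere x r \ {s}) = 0) : f =ᵐ[μ] g := by
  have heq (r : ℝ) : ∫⁻ y in closedBall x r, f y ∂μ = ∫⁻ y in closedBall x r, g y ∂μ := by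
    rw [hfw.setLIntegral_closedBall, hgw.setLIntegral_closedBall]
  filter_upwards [hfw.ae_eq_of_hasRoom hw, hgw.ae_eq_of_hasRoom hw,
    ae_eq_of_not_hasRoom hf hg hfin hone hfw.setLIntegral_closedBall_le_one heq]
    with y hfy hgy hy
  by_cases hroom : HasRoom μ x f y
  · rw [hfy hroom, hgy ((heq _).symm.trans_lt hroom)]
  · exact hy hroom

end Uniqueness

section DeferredAcceptance

variable {E : Type*} [PseudoMetricSpace E] [MeasurableSpace E]

/-- When `w y` are the offers received by `y`, the largest offer to `x` that `y` can make: all of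
it but the part of the offer `w y x` that `y` rejects. -/
noncomputable def counterOffer (μ : Measure E) (w : E → E → ℝ≥0∞) (x y : E) : ℝ≥0∞ :=
  1 - reject μ y (w y) x

theorem counterOffer_le_one (μ : Measure E) (w : E → E → ℝ≥0∞) (x y : E) :
    counterOffer μ w x y ≤ 1 :=
  tsub_le_self

theorem counterOffer_anti {μ : Measure E} {w w' : E → E → ℝ≥0∞} {x y : E} (h : w y ≤ᵐ[μ] w' y)
    (hx : w y x ≤ w' y x) : counterOffer μ w' x y ≤ counterOffer μ w x y :=
  tsub_le_tsub_left (reject_mono h hx) 1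

theorem accept_add_one {μ : Measure E} {w : E → E → ℝ≥0∞} {x y : E} (h : w y x ≤ 1) :
    accept μ y (w y) x + 1 = w y x + counterOffer μ w x y := by
  have hreject : reject μ y (w y) x ≤ 1 := (reject_le μ y (w y) x).trans h
  rw [← accept_add_reject μ y (w y) x, add_assoc, counterOffer, add_tsub_cancel_of_le hreject]

/-- Deferred acceptance between sites, carrying the measure `φ`, and centers, carrying `ψ`:
`avail a b n φ ψ x ξ` is what the center `ξ` offers to the site `x` after `n` rounds, in which the
two sides respond in turn to each other's offers. The first offers are `a` or `b`, according to
whether `n` is even or odd. -/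
noncomputable def avail (a b : ℝ≥0∞) : ℕ → Measure E → Measure E → E → E → ℝ≥0∞
  | 0, _, _ => fun _ _ => a
  | n + 1, φ, ψ => counterOffer φ (avail b a n ψ φ)

theorem avail_le_one {a b : ℝ≥0∞} (ha : a ≤ 1) (n : ℕ) (φ ψ : Measure E) (x ξ : E) :
    avail a b n φ ψ x ξ ≤ 1 := by
  cases n with
  | zero => exact ha
  | succ n => exact counterOffer_le_one _ _ _ _

theorem avail_mono {a a' b b' : ℝ≥0∞} (ha : a ≤ a') (hb : b' ≤ b) (n : ℕ) (φ ψ : Measure E) :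
    avail a b n φ ψ ≤ avail a' b' n φ ψ := by
  induction n generalizing a a' b b' φ ψ with
  | zero => exact fun _ _ => ha
  | succ n ih =>
    exact fun x ξ => counterOffer_anti (.of_forall (ih hb ha ψ φ ξ)) (ih hb ha ψ φ ξ x)

theorem avail_succ_le_and_le_avail_succ (n : ℕ) (φ ψ : Measure E) :
    avail 1 0 (n + 1) φ ψ ≤ avail 1 0 n φ ψ ∧ avail 0 1 n φ ψ ≤ avail 0 1 (n + 1) φ ψ := by
  induction n generalizing φ ψ with
  | zero => exact ⟨fun _ _ => counterOffer_le_one _ _ _ _, fun _ _ => zero_le⟩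
  | succ n ih =>
    exact ⟨fun x ξ => counterOffer_anti (.of_forall ((ih ψ φ).2 ξ)) ((ih ψ φ).2 ξ x),
      fun x ξ => counterOffer_anti (.of_forall ((ih ψ φ).1 ξ)) ((ih ψ φ).1 ξ x)⟩

theorem antitone_avail_one_zero (φ ψ : Measure E) : Antitone fun n => avail 1 0 n φ ψ :=
  antitone_nat_of_succ_le fun n => (avail_succ_le_and_le_avail_succ n φ ψ).1

theorem monotone_avail_zero_one (φ ψ : Measure E) : Monotone fun n => avail 0 1 n φ ψ :=
  monotone_nat_of_le_succ fun n => (avail_succ_le_and_le_avail_succ n φ ψ).2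

/-- The limit of deferred acceptance started from the most generous offers to the `φ`-side. -/
noncomputable def upperAvail (φ ψ : Measure E) (x ξ : E) : ℝ≥0∞ :=
  ⨅ n, avail 1 0 n φ ψ x ξ

/-- The limit of deferred acceptance started from no offers to the `φ`-side. -/
noncomputable def lowerAvail (φ ψ : Measure E) (x ξ : E) : ℝ≥0∞ :=
  ⨆ n, avail 0 1 n φ ψ x ξ

theorem tendsto_avail_upperAvail (φ ψ : Measure E) (x ξ : E) :
    Tendsto (fun n => avail 1 0 n φ ψ x ξ) atTop (𝓝 (upperAvail φ ψ x ξ)) :=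
  tendsto_atTop_iInf fun _ _ h => antitone_avail_one_zero φ ψ h x ξ

theorem tendsto_avail_lowerAvail (φ ψ : Measure E) (x ξ : E) :
    Tendsto (fun n => avail 0 1 n φ ψ x ξ) atTop (𝓝 (lowerAvail φ ψ x ξ)) :=
  tendsto_atTop_iSup fun _ _ h => monotone_avail_zero_one φ ψ h x ξ

theorem upperAvail_le_one (φ ψ : Measure E) (x ξ : E) : upperAvail φ ψ x ξ ≤ 1 :=
  iInf_le _ 0

theorem lowerAvail_le_upperAvail (φ ψ : Measure E) (x ξ : E) :
    lowerAvail φ ψ x ξ ≤ upperAvail φ ψ x ξ :=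
  le_of_tendsto_of_tendsto' (tendsto_avail_lowerAvail φ ψ x ξ) (tendsto_avail_upperAvail φ ψ x ξ)
    fun n => avail_mono zero_le_one zero_le_one n φ ψ x ξ

end DeferredAcceptance

section Measurability

open ProbabilityTheory Function

variable {α E : Type*} [MeasurableSpace α] [MeasurableSpace E]

theorem measurable_setLIntegral_kernel (κ : Kernel α E) [IsSFiniteKernel κ] {w : α → E → ℝ≥0∞}
    (hw : Measurable (uncurry w)) {A : α → Set E}
    (hA : MeasurableSet {p : α × E | p.2 ∈ A p.1}) :
    Measurable fun a => ∫⁻ y in A a, w a y ∂κ a := by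
  have hAa (a : α) : MeasurableSet (A a) := measurable_prodMk_left hA
  simp_rw [← lintegral_indicator (hAa _)]
  exact Measurable.lintegral_kernel_prod_right (hw.indicator hA)

variable [PseudoMetricSpace E] [BorelSpace E] [SecondCountableTopology E]

theorem measurable_setLIntegral_closedBall (κ : Kernel α E) [IsSFiniteKernel κ]
    {w : α → E → ℝ≥0∞} (hw : Measurable (uncurry w)) {c : α → E} (hc : Measurable c) {r : α → ℝ}
    (hr : Measurable r) : Measurable fun a => ∫⁻ y in closedBall (c a) (r a), w a y ∂κ a :=
  measurable_setLIntegral_kernel κ hw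
    (measurableSet_le (f := fun p : α × E => dist p.2 (c p.1)) (by fun_prop) (by fun_prop))

theorem measurable_share (κ : Kernel α E) [IsSFiniteKernel κ] {w : α → E → ℝ≥0∞}
    (hw : Measurable (uncurry w)) {c : α → E} (hc : Measurable c) {r : α → ℝ}
    (hr : Measurable r) : Measurable fun a => share ((κ a).withDensity (w a)) (c a) (r a) := by
  simp only [share, withDensity_apply _ measurableSet_ball,
    withDensity_apply _ isClosed_sphere.measurableSet]
  refine measurable_const.min (((measurable_setLIntegral_kernel κ hw ?_).const_sub 1).div
    (measurable_setLIntegral_kernel κ hw ?_))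
  · exact measurableSet_lt (f := fun p : α × E => dist p.2 (c p.1)) (by fun_prop) (by fun_prop)
  · exact measurableSet_eq_fun (f := fun p : α × E => dist p.2 (c p.1)) (by fun_prop) (by fun_prop)

theorem measurable_share_dist (κ : Kernel α E) [IsSFiniteKernel κ] {w : α → E → ℝ≥0∞}
    (hw : Measurable (uncurry w)) {c : α → E} (hc : Measurable c) :
    Measurable fun p : α × E =>
      share ((κ p.1).withDensity (w p.1)) (c p.1) (dist p.2 (c p.1)) :=
  measurable_share (κ.comap Prod.fst measurable_fst) (w := fun p : α × E => w p.1)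
    (hw.comp (by fun_prop : Measurable fun q : (α × E) × E => (q.1.1, q.2)))
    (c := fun p => c p.1) (by fun_prop) (by fun_prop)

theorem measurable_accept (μ : Measure E) [SFinite μ] (x : E) {w : E → ℝ≥0∞}
    (hw : Measurable w) : Measurable (accept μ x w) :=
  hw.mul (measurable_share (Kernel.const E μ) (w := fun _ => w) (hw.comp measurable_snd)
    measurable_const (measurable_id.dist measurable_const))

theorem measurable_counterOffer (κ : Kernel α E) [IsSFiniteKernel κ] {w : α → E → E → ℝ≥0∞}
    (hw : Measurable fun p : α × E × E => w p.1 p.2.1 p.2.2) :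
    Measurable fun p : α × E × E => counterOffer (κ p.1) (w p.1) p.2.1 p.2.2 := by
  have hw' : Measurable (uncurry fun p : α × E => w p.1 p.2) :=
    hw.comp (by fun_prop : Measurable fun q : (α × E) × E => (q.1.1, q.1.2, q.2))
  have hreject := hw'.mul
    ((measurable_share_dist (κ.comap Prod.fst measurable_fst) hw' measurable_snd).const_sub 1)
  exact (hreject.comp
    (by fun_prop : Measurable fun p : α × E × E => ((p.1, p.2.2), p.2.1))).const_sub 1

theorem measurable_avail (κ η : Kernel α E) [IsSFiniteKernel κ] [IsSFiniteKernel η]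
    (a b : ℝ≥0∞) (n : ℕ) :
    Measurable fun p : α × E × E => avail a b n (κ p.1) (η p.1) p.2.1 p.2.2 := by
  induction n generalizing κ η a b with
  | zero => exact measurable_const
  | succ n ih =>
    exact measurable_counterOffer κ (w := fun ω => avail b a n (η ω) (κ ω)) (ih η κ b a)

theorem measurable_upperAvail (κ η : Kernel α E) [IsSFiniteKernel κ] [IsSFiniteKernel η] :
    Measurable fun p : α × E × E => upperAvail (κ p.1) (η p.1) p.2.1 p.2.2 :=
  Measurable.iInf fun n => measurable_avail κ η 1 0 n

theorem measurable_lowerAvail (κ η : Kernel α E) [IsSFiniteKernel κ] [IsSFiniteKernel η] :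
    Measurable fun p : α × E × E => lowerAvail (κ p.1) (η p.1) p.2.1 p.2.2 :=
  Measurable.iSup fun n => measurable_avail κ η 0 1 n

variable (φ ψ : Measure E) [SFinite φ] [SFinite ψ]

theorem measurable_uncurry_avail (a b : ℝ≥0∞) (n : ℕ) :
    Measurable (uncurry (avail a b n φ ψ)) :=
  (measurable_avail (Kernel.const Unit φ) (Kernel.const Unit ψ) a b n).comp
    (measurable_prodMk_left (x := ()))

theorem measurable_uncurry_upperAvail : Measurable (uncurry (upperAvail φ ψ)) :=
  Measurable.iInf fun n => measurable_uncurry_avail φ ψ 1 0 n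

end Measurability

section LimitDensity

variable {E : Type*} [PseudoMetricSpace E] [MeasurableSpace E]

/-- The density that deferred acceptance started from the most generous offers to the `φ`-side
converges to: the `φ`-side receives `upperAvail φ ψ`, the `ψ`-side `lowerAvail ψ φ`, and together
they exceed one by what is accepted. -/
noncomputable def limitDensity (φ ψ : Measure E) (x ξ : E) : ℝ≥0∞ :=
  upperAvail φ ψ x ξ + lowerAvail ψ φ ξ x - 1

/-- The mass that `limitDensity φ ψ` moves from `x` within distance `r`. -/
noncomputable def upperMass (φ ψ : Measure E) (x : E) (r : ℝ) : ℝ≥0∞ :=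
  cappedMass ψ (upperAvail φ ψ x) x r

/-- The mass that `limitDensity ψ φ` moves to `x` from within distance `r`. -/
noncomputable def lowerMass (φ ψ : Measure E) (x : E) (r : ℝ) : ℝ≥0∞ :=
  cappedMass ψ (lowerAvail φ ψ x) x r

theorem lowerMass_le_upperMass (φ ψ : Measure E) (x : E) (r : ℝ) :
    lowerMass φ ψ x r ≤ upperMass φ ψ x r :=
  cappedMass_mono (.of_forall (lowerAvail_le_upperAvail φ ψ x)) x r

theorem measurable_limitDensity [BorelSpace E] [SecondCountableTopology E] {α : Type*}
    [MeasurableSpace α] (κ η : ProbabilityTheory.Kernel α E) [ProbabilityTheory.IsSFiniteKernel κ]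
    [ProbabilityTheory.IsSFiniteKernel η] :
    Measurable fun p : α × E × E => limitDensity (κ p.1) (η p.1) p.2.1 p.2.2 :=
  ((measurable_upperAvail κ η).add ((measurable_lowerAvail η κ).comp
    (by fun_prop : Measurable fun p : α × E × E => (p.1, p.2.2, p.2.1)))).sub_const 1

theorem tendsto_accept_upper (φ ψ : Measure E) (x ξ : E) :
    Tendsto (fun n => accept ψ x (avail 1 0 n φ ψ x) ξ) atTop (𝓝 (limitDensity φ ψ x ξ)) := by
  simp only [ENNReal.eq_sub_of_add_eq ENNReal.one_ne_top
    (accept_add_one (avail_le_one le_rfl _ φ ψ x ξ))]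
  exact ENNReal.Tendsto.sub ((tendsto_avail_upperAvail φ ψ x ξ).add
    ((tendsto_avail_lowerAvail ψ φ ξ x).comp (tendsto_add_atTop_nat 1))) tendsto_const_nhds
    (.inr ENNReal.one_ne_top)

theorem tendsto_accept_lower (φ ψ : Measure E) (x ξ : E) :
    Tendsto (fun n => accept φ ξ (avail 0 1 n ψ φ ξ) x) atTop (𝓝 (limitDensity φ ψ x ξ)) := by
  simp only [ENNReal.eq_sub_of_add_eq ENNReal.one_ne_top
    (accept_add_one (avail_le_one zero_le_one _ ψ φ ξ x))]
  rw [limitDensity, add_comm]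
  exact ENNReal.Tendsto.sub ((tendsto_avail_lowerAvail ψ φ ξ x).add
    ((tendsto_avail_upperAvail φ ψ x ξ).comp (tendsto_add_atTop_nat 1))) tendsto_const_nhds
    (.inr ENNReal.one_ne_top)

variable [BorelSpace E] [ProperSpace E]

theorem isGreedyChoice_of_tendsto_accept {μ : Measure E} [IsLocallyFiniteMeasure μ] {x : E}
    {w : ℕ → E → ℝ≥0∞} {w' f : E → ℝ≥0∞} (hw : ∀ n, Measurable (w n)) (hw1 : ∀ n y, w n y ≤ 1)
    (hwlim : ∀ y, Tendsto (fun n => w n y) atTop (𝓝 (w' y)))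
    (hflim : ∀ y, Tendsto (fun n => accept μ x (w n) y) atTop (𝓝 (f y))) :
    IsGreedyChoice μ x w' f := by
  have hone (r : ℝ) : ∫⁻ _ in closedBall x r, 1 ∂μ ≠ ∞ := by
    rw [setLIntegral_one]
    exact measure_closedBall_lt_top.ne
  have hwfin (n : ℕ) (r : ℝ) : ∫⁻ y in closedBall x r, w n y ∂μ ≠ ∞ :=
    ((lintegral_mono (hw1 n)).trans_lt (hone r).lt_top).ne
  exact .of_tendsto (fun n => isGreedyChoice_accept (hw n) (hwfin n)) hw
    (fun n => measurable_accept μ x (hw n)) (fun n => .of_forall (hw1 n)) hone hwlim hflim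

theorem upperMass_le_lowerMass_of_rat {φ ψ : Measure E} [IsLocallyFiniteMeasure ψ] {x : E}
    (h : ∀ q : ℚ, upperMass φ ψ x q ≤ lowerMass φ ψ x q) (r : ℝ) :
    upperMass φ ψ x r ≤ lowerMass φ ψ x r := by
  have hfin (ρ : ℝ) : ψ.withDensity (lowerAvail φ ψ x) (closedBall x ρ) ≠ ∞ := by
    rw [withDensity_apply _ measurableSet_closedBall]
    refine ((lintegral_mono fun ξ => (lowerAvail_le_upperAvail φ ψ x ξ).trans
      (upperAvail_le_one φ ψ x ξ)).trans_lt ?_).ne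
    rw [setLIntegral_one]
    exact measure_closedBall_lt_top
  refine le_min (min_le_left _ _) ?_
  rw [← withDensity_apply _ measurableSet_closedBall]
  refine le_measure_closedBall_of_forall_gt hfin fun ρ hρ => ?_
  obtain ⟨q, hrq, hqρ⟩ := exists_rat_btwn hρ
  rw [withDensity_apply _ measurableSet_closedBall]
  calc upperMass φ ψ x r
      ≤ upperMass φ ψ x q :=
        min_le_min_left _ (lintegral_mono_set (closedBall_subset_closedBall hrq.le))
    _ ≤ lowerMass φ ψ x q := h q
    _ ≤ ∫⁻ ξ in closedBall x q, lowerAvail φ ψ x ξ ∂ψ := min_le_right _ _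
    _ ≤ ∫⁻ ξ in closedBall x ρ, lowerAvail φ ψ x ξ ∂ψ :=
        lintegral_mono_set (closedBall_subset_closedBall hqρ.le)

variable (φ ψ : Measure E) [IsLocallyFiniteMeasure φ] [IsLocallyFiniteMeasure ψ]

theorem isGreedyChoice_limitDensity_left (x : E) :
    IsGreedyChoice ψ x (upperAvail φ ψ x) (limitDensity φ ψ x) :=
  isGreedyChoice_of_tendsto_accept
    (fun n => (measurable_uncurry_avail φ ψ 1 0 n).of_uncurry_left)
    (fun n => avail_le_one le_rfl n φ ψ x) (tendsto_avail_upperAvail φ ψ x)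
    (tendsto_accept_upper φ ψ x)

theorem isGreedyChoice_limitDensity_right (ξ : E) :
    IsGreedyChoice φ ξ (lowerAvail ψ φ ξ) fun x => limitDensity φ ψ x ξ :=
  isGreedyChoice_of_tendsto_accept
    (fun n => (measurable_uncurry_avail ψ φ 0 1 n).of_uncurry_left)
    (fun n => avail_le_one zero_le_one n ψ φ ξ) (tendsto_avail_lowerAvail ψ φ ξ)
    fun x => tendsto_accept_lower φ ψ x ξ

end LimitDensity

section Comparison

open Function

variable {E : Type*} [PseudoMetricSpace E] [MeasurableSpace E] [BorelSpace E]
  [SecondCountableTopology E] {φ ψ : Measure E} [SFinite φ] [SFinite ψ]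

theorem ae_le_avail_and_ae_avail_le {u v : E → E → ℝ≥0∞} (hu : Measurable (uncurry u))
    (hv : Measurable (uncurry v)) (hu1 : ∀ x ξ, u x ξ ≤ 1)
    (huv : ∀ᵐ ξ ∂ψ, ∀ᵐ x ∂φ, u x ξ ≤ counterOffer φ v x ξ)
    (hvu : ∀ᵐ x ∂φ, ∀ᵐ ξ ∂ψ, counterOffer ψ u ξ x ≤ v ξ x) (n : ℕ) :
    (∀ᵐ x ∂φ, u x ≤ᵐ[ψ] avail 1 0 n φ ψ x) ∧ ∀ᵐ ξ ∂ψ, avail 0 1 n ψ φ ξ ≤ᵐ[φ] v ξ := by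
  induction n with
  | zero => exact ⟨.of_forall fun x => .of_forall (hu1 x), .of_forall fun ξ => .of_forall fun x =>
      zero_le⟩
  | succ n ih =>
    constructor
    · have hmeas : MeasurableSet {p : E × E | u p.1 p.2 ≤ avail 1 0 (n + 1) φ ψ p.1 p.2} :=
        measurableSet_le hu (measurable_uncurry_avail φ ψ 1 0 (n + 1))
      refine (Measure.ae_ae_comm hmeas).2 ?_
      filter_upwards [ih.2, huv] with ξ hle hξ
      filter_upwards [hle, hξ] with x hx hux using hux.trans (counterOffer_anti hle hx)
    · have hmeas : MeasurableSet {p : E × E | avail 0 1 (n + 1) ψ φ p.1 p.2 ≤ v p.1 p.2} :=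
        measurableSet_le (measurable_uncurry_avail ψ φ 0 1 (n + 1)) hv
      refine (Measure.ae_ae_comm hmeas).2 ?_
      filter_upwards [ih.1, hvu] with x hle hx
      filter_upwards [hle, hx] with ξ hξ hvξ using (counterOffer_anti hle hξ).trans hvξ

theorem ae_le_upperAvail_and_ae_lowerAvail_le {u v : E → E → ℝ≥0∞} (hu : Measurable (uncurry u))
    (hv : Measurable (uncurry v)) (hu1 : ∀ x ξ, u x ξ ≤ 1)
    (huv : ∀ᵐ ξ ∂ψ, ∀ᵐ x ∂φ, u x ξ ≤ counterOffer φ v x ξ)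
    (hvu : ∀ᵐ x ∂φ, ∀ᵐ ξ ∂ψ, counterOffer ψ u ξ x ≤ v ξ x) :
    (∀ᵐ x ∂φ, u x ≤ᵐ[ψ] upperAvail φ ψ x) ∧ ∀ᵐ ξ ∂ψ, lowerAvail ψ φ ξ ≤ᵐ[φ] v ξ := by
  have h := ae_le_avail_and_ae_avail_le hu hv hu1 huv hvu
  constructor
  · filter_upwards [ae_all_iff.2 fun n => (h n).1] with x hx
    filter_upwards [ae_all_iff.2 hx] with ξ hξ using le_iInf hξ
  · filter_upwards [ae_all_iff.2 fun n => (h n).2] with ξ hξ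
    filter_upwards [ae_all_iff.2 hξ] with x hx using iSup_le hx

end Comparison

section OffersOfDensity

variable {E : Type*} [PseudoMetricSpace E] [MeasurableSpace E] {φ : Measure E} {f : E → E → ℝ≥0}

open Classical in
/-- The largest offer that `x` can obtain from `ξ` given the density `f`: `ξ` accepts everything
from `x` if `f` leaves it with room, and insists on `f x ξ` otherwise. -/
noncomputable def siteOffer (φ : Measure E) (f : E → E → ℝ≥0) (x ξ : E) : ℝ≥0∞ :=
  if HasRoom φ ξ (fun z => f z ξ) x then 1 else f x ξ

open Classical in
/-- The offer from `x` to `ξ` that is complementary to `siteOffer`: one of the two equals `f x ξ`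
and the other equals one. -/
noncomputable def centerOffer (φ : Measure E) (f : E → E → ℝ≥0) (ξ x : E) : ℝ≥0∞ :=
  if HasRoom φ ξ (fun z => f z ξ) x then f x ξ else 1

theorem siteOffer_add_centerOffer (φ : Measure E) (f : E → E → ℝ≥0) (x ξ : E) :
    siteOffer φ f x ξ + centerOffer φ f ξ x = f x ξ + 1 := by
  unfold siteOffer centerOffer
  split_ifs
  · exact add_comm _ _
  · rfl

theorem siteOffer_mem_Icc {x ξ : E} (h : f x ξ ≤ 1) :
    siteOffer φ f x ξ ∈ Icc (f x ξ : ℝ≥0∞) 1 := by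
  have h' : (f x ξ : ℝ≥0∞) ≤ 1 := ENNReal.coe_le_one_iff.2 h
  unfold siteOffer
  split_ifs
  exacts [⟨h', le_rfl⟩, ⟨le_rfl, h'⟩]

theorem centerOffer_mem_Icc {x ξ : E} (h : f x ξ ≤ 1) :
    centerOffer φ f ξ x ∈ Icc (f x ξ : ℝ≥0∞) 1 := by
  have h' : (f x ξ : ℝ≥0∞) ≤ 1 := ENNReal.coe_le_one_iff.2 h
  unfold centerOffer
  split_ifs
  exacts [⟨le_rfl, h'⟩, ⟨h', le_rfl⟩]

variable [BorelSpace E] [SecondCountableTopology E] [SFinite φ]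

theorem measurableSet_hasRoom (hf : Measurable fun p : E × E => f p.1 p.2) :
    MeasurableSet {p : E × E | HasRoom φ p.2 (fun z => f z p.2) p.1} := by
  have hw : Measurable fun q : (E × E) × E => (f q.2 q.1.2 : ℝ≥0∞) :=
    (hf.comp (by fun_prop : Measurable fun q : (E × E) × E => (q.2, q.1.2))).coe_nnreal_ennreal
  exact measurableSet_lt (measurable_setLIntegral_closedBall (ProbabilityTheory.Kernel.const _ φ)
    hw measurable_snd (measurable_fst.dist measurable_snd)) measurable_const

theorem measurable_siteOffer (hf : Measurable fun p : E × E => f p.1 p.2) :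
    Measurable fun p : E × E => siteOffer φ f p.1 p.2 :=
  .ite (measurableSet_hasRoom hf) measurable_const hf.coe_nnreal_ennreal

theorem measurable_centerOffer (hf : Measurable fun p : E × E => f p.1 p.2) :
    Measurable fun p : E × E => centerOffer φ f p.1 p.2 :=
  have h : Measurable fun p : E × E => centerOffer φ f p.2 p.1 :=
    .ite (measurableSet_hasRoom hf) hf.coe_nnreal_ennreal measurable_const
  h.comp measurable_swap

end OffersOfDensity

section GreedyCounterOffer

variable {E : Type*} [MetricSpace E] [ProperSpace E] [MeasurableSpace E] [BorelSpace E]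
  {μ : Measure E} [IsLocallyFiniteMeasure μ]

theorem IsGreedyChoice.ae_add_one_eq {w : E → E → ℝ≥0∞} {f : E → ℝ≥0∞} {y : E}
    (h : IsGreedyChoice μ y (w y) f) (hf : Measurable f) (hw : Measurable (w y))
    (hw1 : ∀ x, w y x ≤ 1)
    (hone : ∀ r : ℝ, 0 < r → ∃ s ∈ sphere y r, μ (sphere y r \ {s}) = 0) :
    ∀ᵐ x ∂μ, f x + 1 = w y x + counterOffer μ w x y := by
  have hfin (r : ℝ) : μ (closedBall y r) ≠ ∞ := measure_closedBall_lt_top.ne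
  have hwfin (r : ℝ) : ∫⁻ x in closedBall y r, w y x ∂μ ≠ ∞ :=
    ((lintegral_mono hw1).trans_lt (setLIntegral_one _ ▸ (hfin r).lt_top)).ne
  filter_upwards [h.ae_eq (isGreedyChoice_accept hw hwfin) hf (measurable_accept μ y hw) hw hfin
    hone] with x hx
  rw [hx, accept_add_one (hw1 x)]

end GreedyCounterOffer

section StableDensity

variable {d : ℕ} {φ ψ : Measure (Space d)} {f : Space d → Space d → ℝ≥0}

theorem IsStableConstrained.swap (hf : IsStableConstrained φ ψ f) :
    IsStableConstrained ψ φ fun ξ x => f x ξ where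
  measurable := hf.measurable.comp measurable_swap
  site_le := hf.center_le
  center_le := hf.site_le
  le_one ξ x := hf.le_one x ξ
  stable := by
    rintro ξ x ⟨⟨hlt, hcenter⟩, -, hsite⟩
    refine hf.stable x ξ ⟨⟨hlt, ?_⟩, hlt, ?_⟩
    · simpa only [Sated, Exhausted, dist_comm] using hsite
    · simpa only [Sated, Exhausted, dist_comm] using hcenter

theorem exists_pos_of_hasRoom {E : Type*} [PseudoMetricSpace E] [MeasurableSpace E]
    [OpensMeasurableSpace E] {μ : Measure E} {h : E → ℝ≥0} {x y : E}
    (htot : ∫⁻ z, (h z : ℝ≥0∞) ∂μ = 1) (hroom : HasRoom μ x (fun z => h z) y) :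
    ∃ z, dist y x < dist z x ∧ 0 < h z := by
  by_contra! hfar
  refine hroom.ne ((setLIntegral_eq_of_support_subset fun z hz => ?_).trans htot)
  exact not_lt.1 fun hzx => hz (by simpa using hfar z hzx)

theorem IsStableConstrained.eq_one (hf : IsStableConstrained φ ψ f) {x ξ : Space d}
    (hx : HasRoom ψ x (fun z => f x z) ξ) (hξ : HasRoom φ ξ (fun z => f z ξ) x) : f x ξ = 1 := by
  by_contra hne
  have hlt : f x ξ < 1 := lt_of_le_of_ne (hf.le_one x ξ) hne
  refine hf.stable x ξ ⟨⟨hlt, or_iff_not_imp_left.2 fun h => ?_⟩,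
    ⟨hlt, or_iff_not_imp_left.2 fun h => exists_pos_of_hasRoom (not_not.1 h) hξ⟩⟩
  simpa only [dist_comm _ x] using exists_pos_of_hasRoom (not_not.1 h) hx

theorem IsStableConstrained.isGreedyChoice_siteOffer (hf : IsStableConstrained φ ψ f)
    (x : Space d) : IsGreedyChoice ψ x (siteOffer φ f x) fun ξ => f x ξ :=
  isGreedyChoice_of_eq_of_hasRoom (hf.site_le x) (fun ξ => (siteOffer_mem_Icc (hf.le_one x ξ)).1)
    fun ξ hx => by
      unfold siteOffer
      split_ifs with hξ
      exacts [by rw [hf.eq_one hx hξ, ENNReal.coe_one], rfl]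

theorem IsConstrained.isGreedyChoice_centerOffer (hf : IsConstrained φ ψ f) (ξ : Space d) :
    IsGreedyChoice φ ξ (centerOffer φ f ξ) fun x => f x ξ :=
  isGreedyChoice_of_eq_of_hasRoom (hf.center_le ξ)
    (fun x => (centerOffer_mem_Icc (hf.le_one x ξ)).1) fun _ hξ => (if_pos hξ).symm

variable [IsLocallyFiniteMeasure φ] [IsLocallyFiniteMeasure ψ]

theorem IsStableConstrained.ae_siteOffer_le_and_ae_le_centerOffer (hf : IsStableConstrained φ ψ f)
    (hA : UniquenessAssumption φ ψ) :
    (∀ᵐ x ∂φ, siteOffer φ f x ≤ᵐ[ψ] upperAvail φ ψ x) ∧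
      ∀ᵐ ξ ∂ψ, lowerAvail ψ φ ξ ≤ᵐ[φ] centerOffer φ f ξ := by
  have hsite := measurable_siteOffer (φ := φ) hf.measurable
  have hcenter := measurable_centerOffer (φ := φ) hf.measurable
  refine ae_le_upperAvail_and_ae_lowerAvail_le hsite hcenter
    (fun x ξ => (siteOffer_mem_Icc (hf.le_one x ξ)).2) ?_ ?_
  · filter_upwards [hA.2] with ξ hξ
    filter_upwards [(hf.isGreedyChoice_centerOffer ξ).ae_add_one_eq
      hf.measurable.of_uncurry_right.coe_nnreal_ennreal hcenter.of_uncurry_left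
      (fun x => (centerOffer_mem_Icc (hf.le_one x ξ)).2) hξ] with x hx
    rw [← siteOffer_add_centerOffer φ f x ξ, add_comm] at hx
    exact (ENNReal.add_right_inj (ne_top_of_le_ne_top ENNReal.one_ne_top
      (centerOffer_mem_Icc (hf.le_one x ξ)).2)).1 hx |>.le
  · filter_upwards [hA.1] with x hx
    filter_upwards [(hf.isGreedyChoice_siteOffer x).ae_add_one_eq
      hf.measurable.of_uncurry_left.coe_nnreal_ennreal hsite.of_uncurry_left
      (fun ξ => (siteOffer_mem_Icc (hf.le_one x ξ)).2) hx] with ξ hξ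
    rw [← siteOffer_add_centerOffer φ f x ξ] at hξ
    exact (ENNReal.add_right_inj (ne_top_of_le_ne_top ENNReal.one_ne_top
      (siteOffer_mem_Icc (hf.le_one x ξ)).2)).1 hξ |>.ge

theorem IsStableConstrained.ae_lowerMass_le (hf : IsStableConstrained φ ψ f)
    (hA : UniquenessAssumption φ ψ) :
    ∀ᵐ x ∂φ, ∀ r, lowerMass φ ψ x r ≤ ∫⁻ ξ in closedBall x r, f x ξ ∂ψ := by
  filter_upwards [(hf.swap.ae_siteOffer_le_and_ae_le_centerOffer hA.symm).2] with x hx r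
  rw [(hf.swap.isGreedyChoice_centerOffer x).setLIntegral_closedBall]
  exact cappedMass_mono hx x r

theorem IsStableConstrained.ae_isGreedyChoice_upperAvail (hf : IsStableConstrained φ ψ f)
    (hA : UniquenessAssumption φ ψ)
    (hmass : ∀ᵐ x ∂φ, ∀ r, upperMass φ ψ x r ≤ lowerMass φ ψ x r) :
    ∀ᵐ x ∂φ, IsGreedyChoice ψ x (upperAvail φ ψ x) fun ξ => f x ξ := by
  filter_upwards [(hf.ae_siteOffer_le_and_ae_le_centerOffer hA).1, hf.ae_lowerMass_le hA, hmass]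
    with x hupper hlower hx
  have hgreedy := hf.isGreedyChoice_siteOffer x
  refine ⟨hgreedy.le.trans hupper, fun r => le_antisymm ?_ ((hx r).trans (hlower r))⟩
  exact (hgreedy.setLIntegral_closedBall r).trans_le (cappedMass_mono hupper x r)

theorem IsStableConstrained.ae_eq {g : Space d → Space d → ℝ≥0} (hf : IsStableConstrained φ ψ f)
    (hg : IsStableConstrained φ ψ g) (hA : UniquenessAssumption φ ψ)
    (hmass : ∀ᵐ x ∂φ, ∀ r, upperMass φ ψ x r ≤ lowerMass φ ψ x r) :
    ∀ᵐ p ∂φ.prod ψ, f p.1 p.2 = g p.1 p.2 := by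
  refine (Measure.ae_prod_iff_ae_ae (measurableSet_eq_fun hf.measurable hg.measurable)).2 ?_
  filter_upwards [hA.1, hf.ae_isGreedyChoice_upperAvail hA hmass,
    hg.ae_isGreedyChoice_upperAvail hA hmass] with x hx hfx hgx
  filter_upwards [hfx.ae_eq hgx hf.measurable.of_uncurry_left.coe_nnreal_ennreal
    hg.measurable.of_uncurry_left.coe_nnreal_ennreal
    (measurable_uncurry_upperAvail φ ψ).of_uncurry_left
    (fun r => measure_closedBall_lt_top.ne) hx] with ξ hξ using ENNReal.coe_injective hξ

end StableDensity

section Equivariance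

variable {E F : Type*} [PseudoMetricSpace E] [MeasurableSpace E] [BorelSpace E]
  [PseudoMetricSpace F] [MeasurableSpace F] [BorelSpace F] (e : E ≃ᵢ F)

theorem share_map (ν : Measure E) (x : E) (r : ℝ) : share (ν.map e) (e x) r = share ν x r := by
  have he : MeasurableEmbedding e := e.toHomeomorph.measurableEmbedding
  rw [share, share, he.map_apply, he.map_apply, e.preimage_ball, e.preimage_sphere,
    e.symm_apply_apply]

theorem withDensity_map_isometryEquiv (μ : Measure E) (w : F → ℝ≥0∞) :
    (μ.map e).withDensity w = (μ.withDensity (w ∘ e)).map e := by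
  have he : MeasurableEmbedding e := e.toHomeomorph.measurableEmbedding
  ext A hA
  rw [he.map_apply, withDensity_apply _ hA, withDensity_apply _ (he.measurable hA),
    he.restrict_map, he.lintegral_map]
  rfl

theorem counterOffer_map (μ : Measure E) (w : F → F → ℝ≥0∞) (x y : E) :
    counterOffer (μ.map e) w (e x) (e y) = counterOffer μ (fun a b => w (e a) (e b)) x y := by
  rw [counterOffer, counterOffer, reject, reject, withDensity_map_isometryEquiv, share_map,
    e.dist_eq]
  rfl

theorem avail_map (a b : ℝ≥0∞) (n : ℕ) (φ ψ : Measure E) (x ξ : E) :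
    avail a b n (φ.map e) (ψ.map e) (e x) (e ξ) = avail a b n φ ψ x ξ := by
  induction n generalizing a b φ ψ x ξ with
  | zero => rfl
  | succ n ih => simp only [avail, counterOffer_map, ih]

theorem limitDensity_map (φ ψ : Measure E) (x ξ : E) :
    limitDensity (φ.map e) (ψ.map e) (e x) (e ξ) = limitDensity φ ψ x ξ := by
  simp only [limitDensity, upperAvail, lowerAvail, avail_map]

end Equivariance

section MassTransport

open ProbabilityTheory Function

variable {Ω G : Type*} [MeasurableSpace Ω] [MeasurableSpace G]

theorem lintegral_mul_comp_eq_of_measurePreserving [AddGroup G] [MeasurableAdd₂ G]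
    [MeasurableNeg G] (ν : Measure G) [SFinite ν] [ν.IsAddLeftInvariant] [ν.IsNegInvariant]
    {M : Measure Ω} [SFinite M] {T : G → Ω → Ω} (hT : ∀ t, MeasurePreserving (T t) M M)
    {p q : Ω → G} (hp : Measurable p) (hq : Measurable q) (hpT : ∀ t z, p (T t z) = p z - t)
    (hqT : ∀ t z, q (T t z) = q z - t) {w : Ω → ℝ≥0∞} (hw : Measurable w)
    (hwT : ∀ t z, w (T t z) = w z) {k : G → ℝ≥0∞} (hk : Measurable k) (hk0 : ∫⁻ t, k t ∂ν ≠ 0)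
    (hk_top : ∫⁻ t, k t ∂ν ≠ ∞) :
    ∫⁻ z, k (p z) * w z ∂M = ∫⁻ z, k (q z) * w z ∂M := by
  -- Weight by `k` at the other point, translated by `t`, and undo the translation by invariance.
  refine (ENNReal.mul_left_inj hk0 hk_top).1 ?_
  calc (∫⁻ z, k (p z) * w z ∂M) * ∫⁻ t, k t ∂ν
      = ∫⁻ t, ∫⁻ z, k (p z) * w z * k (q z + t) ∂M ∂ν := by
        rw [← lintegral_mul_const _ (by fun_prop), lintegral_lintegral_swap (by fun_prop)]
        refine lintegral_congr fun z => ?_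
        rw [lintegral_const_mul _ (by fun_prop), lintegral_add_left_eq_self]
    _ = ∫⁻ t, ∫⁻ z, k (q z) * w z * k (p z - t) ∂M ∂ν := by
        refine lintegral_congr fun t => ?_
        rw [← (hT t).lintegral_comp (by fun_prop)]
        simp only [hpT, hqT, hwT, sub_add_cancel]
        exact lintegral_congr fun z => by ring
    _ = (∫⁻ z, k (q z) * w z ∂M) * ∫⁻ t, k t ∂ν := by
        rw [← lintegral_mul_const _ (by fun_prop), lintegral_lintegral_swap (by fun_prop)]
        refine lintegral_congr fun z => ?_
        rw [lintegral_const_mul _ (by fun_prop), lintegral_sub_left_eq_self]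

theorem measurePreserving_compProd {P : Measure Ω} [SFinite P] {κ : Kernel Ω G}
    [IsSFiniteKernel κ] {T : Ω → Ω} {σ : G → G} (hT : MeasurePreserving T P P)
    (hσ : Measurable σ) (hκ : ∀ ω, κ (T ω) = (κ ω).map σ) :
    MeasurePreserving (Prod.map T σ) (P ⊗ₘ κ) (P ⊗ₘ κ) := by
  refine ⟨hT.measurable.prodMap hσ, ?_⟩
  ext A hA
  rw [Measure.map_apply (hT.measurable.prodMap hσ) hA, Measure.compProd_apply hA,
    Measure.compProd_apply (hT.measurable.prodMap hσ hA),
    ← hT.lintegral_comp (Kernel.measurable_kernel_prodMk_left hA)]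
  refine lintegral_congr fun ω => ?_
  rw [hκ, Measure.map_apply hσ (measurable_prodMk_left hA)]
  rfl

variable {P : Measure Ω} [SFinite P] {κ η : Kernel Ω G} [IsSFiniteKernel κ] [IsSFiniteKernel η]

/-- The random measure `κ` moves along with the translations under the flow `θ`. -/
def IsFlowAdapted [Sub G] (θ : G → Ω → Ω) (κ : Kernel Ω G) : Prop :=
  ∀ t ω, κ (θ t ω) = (κ ω).map fun x => x - t

theorem mass_transport [AddGroup G] [MeasurableAdd₂ G] [MeasurableNeg G] (ν : Measure G)
    [SFinite ν] [ν.IsAddLeftInvariant] [ν.IsNegInvariant] {θ : G → Ω → Ω}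
    (hθ : ∀ t, MeasurePreserving (θ t) P P) (hκ : IsFlowAdapted θ κ)
    (hη : IsFlowAdapted θ η) {w : Ω → G → G → ℝ≥0∞}
    (hw : Measurable fun z : Ω × G × G => w z.1 z.2.1 z.2.2)
    (hwθ : ∀ t ω x ξ, w (θ t ω) (x - t) (ξ - t) = w ω x ξ) {k : G → ℝ≥0∞} (hk : Measurable k)
    (hk0 : ∫⁻ t, k t ∂ν ≠ 0) (hk_top : ∫⁻ t, k t ∂ν ≠ ∞) :
    ∫⁻ ω, ∫⁻ x, k x * ∫⁻ ξ, w ω x ξ ∂η ω ∂κ ω ∂P =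
      ∫⁻ ω, ∫⁻ ξ, k ξ * ∫⁻ x, w ω x ξ ∂κ ω ∂η ω ∂P := by
  have hT (t : G) : MeasurePreserving (Prod.map (θ t) (Prod.map (· - t) (· - t)))
      (P ⊗ₘ (κ ×ₖ η)) (P ⊗ₘ (κ ×ₖ η)) :=
    measurePreserving_compProd (hθ t) (by fun_prop) fun ω => by
      rw [Kernel.prod_apply, Kernel.prod_apply, hκ, hη,
        Measure.map_prod_map _ _ (by fun_prop) (by fun_prop)]
  have key := lintegral_mul_comp_eq_of_measurePreserving ν hT (p := fun z => z.2.1)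
    (q := fun z => z.2.2) (by fun_prop) (by fun_prop) (fun _ _ => rfl) (fun _ _ => rfl) hw
    (fun t z => hwθ t z.1 z.2.1 z.2.2) hk hk0 hk_top
  rw [Measure.lintegral_compProd (by fun_prop), Measure.lintegral_compProd (by fun_prop)] at key
  convert key using 3 with ω ω
  · rw [Kernel.lintegral_prod _ _ _ (by fun_prop)]
    exact lintegral_congr fun x => (lintegral_const_mul _ (by fun_prop)).symm
  · rw [Kernel.lintegral_prod_symm _ _ _ (by fun_prop)]
    exact lintegral_congr fun ξ => (lintegral_const_mul _ (by fun_prop)).symm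

end MassTransport

section SFiniteKernel

open ProbabilityTheory

variable {α E : Type*} [MeasurableSpace α] [MeasurableSpace E]

theorem isSFiniteKernel_of_isFiniteMeasure (κ : Kernel α E) [∀ a, IsFiniteMeasure (κ a)] :
    IsSFiniteKernel κ := by
  classical
  let level (a : α) : ℕ := ⌊(κ a univ).toReal⌋₊
  have hlevel (k : ℕ) : MeasurableSet {a | level a = k} :=
    Nat.measurable_floor.comp (κ.measurable_coe .univ).ennreal_toReal (measurableSet_singleton k)
  have hsum : κ = Kernel.sum fun k => Kernel.piecewise (hlevel k) κ 0 := by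
    ext a A hA
    rw [Kernel.sum_apply' _ _ hA, tsum_eq_single (level a)]
    · rw [Kernel.piecewise_apply, if_pos (mem_ofPred_eq ▸ rfl)]
    · intro k hk
      have hak : a ∉ {a | level a = k} := fun h => hk (Eq.symm h)
      rw [Kernel.piecewise_apply, if_neg hak]
      rfl
  have hfin (k : ℕ) : IsFiniteKernel (Kernel.piecewise (hlevel k) κ 0) := by
    refine ⟨⟨ENNReal.ofReal (k + 1), ENNReal.ofReal_lt_top, fun a => ?_⟩⟩
    rw [Kernel.piecewise_apply]
    split_ifs with ha
    · obtain rfl : level a = k := ha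
      exact (ENNReal.le_ofReal_iff_toReal_le (measure_ne_top _ _) (by positivity)).2
        (Nat.lt_floor_add_one _).le
    · exact zero_le
  exact hsum ▸ Kernel.isSFiniteKernel_sum

instance isSFiniteKernel_of_isLocallyFiniteMeasure [TopologicalSpace E] [T2Space E]
    [SigmaCompactSpace E] [OpensMeasurableSpace E] (κ : Kernel α E)
    [∀ a, IsLocallyFiniteMeasure (κ a)] : IsSFiniteKernel κ := by
  have hS : ∀ n, MeasurableSet (disjointed (compactCovering E) n) :=
    fun n => .disjointed (fun n => (isCompact_compactCovering E n).measurableSet) n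
  have hsum : κ = Kernel.sum fun n => κ.restrict (hS n) := by
    ext a A hA
    simp only [Kernel.sum_apply' _ _ hA, Kernel.restrict_apply]
    rw [← Measure.sum_apply _ hA, ← Measure.restrict_iUnion (disjoint_disjointed _) hS,
      iUnion_disjointed, iUnion_compactCovering, Measure.restrict_univ]
  have hfin (n : ℕ) (a : α) : IsFiniteMeasure (κ.restrict (hS n) a) := by
    rw [Kernel.restrict_apply, isFiniteMeasure_restrict]
    exact ((measure_mono (disjointed_subset _ n)).trans_lt
      (isCompact_compactCovering E n).measure_lt_top).ne
  have (n : ℕ) : IsSFiniteKernel (κ.restrict (hS n)) := isSFiniteKernel_of_isFiniteMeasure _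
  exact hsum ▸ Kernel.isSFiniteKernel_sum

end SFiniteKernel

theorem HasIntensity.bind_eq {d : ℕ} {Ω : Type*} [MeasurableSpace Ω] {P : Measure Ω}
    {Φ : Ω → Measure (Space d)} {c : ℝ≥0∞} (h : HasIntensity P Φ c) (hΦ : Measurable Φ) :
    P.bind Φ = c • volume := by
  ext B hB
  rw [Measure.bind_apply hB hΦ.aemeasurable, h B hB]
  rfl

theorem exists_pos_lintegral_ne_top {E : Type*} [MeasurableSpace E] (μ ν : Measure E)
    [SigmaFinite μ] [SigmaFinite ν] :
    ∃ k : E → ℝ≥0, (∀ x, 0 < k x) ∧ Measurable k ∧ ∫⁻ x, k x ∂μ ≠ ∞ ∧ ∫⁻ x, k x ∂ν ≠ ∞ := by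
  obtain ⟨k, hk_pos, hk, hk_lt⟩ := exists_pos_lintegral_lt_of_sigmaFinite (μ + ν) one_ne_zero
  rw [lintegral_add_measure] at hk_lt
  exact ⟨k, hk_pos, hk, ENNReal.add_ne_top.1 hk_lt.ne_top⟩

section BalancedMass

open ProbabilityTheory Function

variable {Ω E : Type*} [MeasurableSpace Ω] [NormedAddCommGroup E] [MeasurableSpace E]
  [BorelSpace E]

theorem IsFlowAdapted.limitDensity {θ : E → Ω → Ω} {κ η : Kernel Ω E} (hκ : IsFlowAdapted θ κ)
    (hη : IsFlowAdapted θ η) (t : E) (ω : Ω) (x ξ : E) :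
    limitDensity (κ (θ t ω)) (η (θ t ω)) (x - t) (ξ - t) = limitDensity (κ ω) (η ω) x ξ := by
  rw [hκ, hη]
  exact limitDensity_map (IsometryEquiv.subRight t) (κ ω) (η ω) x ξ

variable [ProperSpace E] {κ η : Kernel Ω E} [∀ ω, IsLocallyFiniteMeasure (κ ω)]
  [∀ ω, IsLocallyFiniteMeasure (η ω)]

theorem measurable_upperMass (r : ℝ) :
    Measurable fun p : Ω × E => upperMass (κ p.1) (η p.1) p.2 r :=
  measurable_const.min ((measurable_setLIntegral_closedBall (η.comap Prod.fst measurable_fst)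
    (w := fun p : Ω × E => upperAvail (κ p.1) (η p.1) p.2)
    ((measurable_upperAvail κ η).comp MeasurableEquiv.prodAssoc.measurable) measurable_snd
    measurable_const))

theorem measurable_lowerMass (r : ℝ) :
    Measurable fun p : Ω × E => lowerMass (κ p.1) (η p.1) p.2 r :=
  measurable_const.min ((measurable_setLIntegral_closedBall (η.comap Prod.fst measurable_fst)
    (w := fun p : Ω × E => lowerAvail (κ p.1) (η p.1) p.2)
    ((measurable_lowerAvail κ η).comp MeasurableEquiv.prodAssoc.measurable) measurable_snd
    measurable_const))

variable {P : Measure Ω} [SFinite P] (ν : Measure E) [ν.IsAddHaarMeasure] {θ : E → Ω → Ω}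
  (hθ : ∀ t, MeasurePreserving (θ t) P P) (hκ : IsFlowAdapted θ κ) (hη : IsFlowAdapted θ η)

include hθ hκ hη

theorem lintegral_mul_upperMass {k : E → ℝ≥0∞} (hk : Measurable k) (hk0 : ∫⁻ t, k t ∂ν ≠ 0)
    (hk_top : ∫⁻ t, k t ∂ν ≠ ∞) (r : ℝ) :
    ∫⁻ ω, ∫⁻ x, k x * upperMass (κ ω) (η ω) x r ∂κ ω ∂P =
      ∫⁻ ω, ∫⁻ ξ, k ξ * lowerMass (η ω) (κ ω) ξ r ∂η ω ∂P := by
  have hdist : MeasurableSet {z : Ω × E × E | dist z.2.2 z.2.1 ≤ r} :=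
    measurableSet_le (by fun_prop) measurable_const
  have key := mass_transport ν hθ hκ hη
    (w := fun ω x => (closedBall x r).indicator (limitDensity (κ ω) (η ω) x))
    ((measurable_limitDensity κ η).indicator hdist) (fun t ω x ξ => by
      simp only [indicator, mem_closedBall, dist_sub_right, hκ.limitDensity hη]) hk hk0 hk_top
  convert key using 6 with ω x ω ξ
  · rw [lintegral_indicator measurableSet_closedBall,
      (isGreedyChoice_limitDensity_left (κ ω) (η ω) x).setLIntegral_closedBall, upperMass]
  · rw [lowerMass,
      ← (isGreedyChoice_limitDensity_right (κ ω) (η ω) ξ).setLIntegral_closedBall,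
      ← lintegral_indicator measurableSet_closedBall]
    exact lintegral_congr fun x => by simp only [indicator, mem_closedBall, dist_comm]

theorem lintegral_mul_upperMass_le {k : E → ℝ≥0∞} (hk : Measurable k) (hk0 : ∫⁻ t, k t ∂ν ≠ 0)
    (hk_top : ∫⁻ t, k t ∂ν ≠ ∞) (r : ℝ) :
    ∫⁻ ω, ∫⁻ x, k x * upperMass (κ ω) (η ω) x r ∂κ ω ∂P ≤
      ∫⁻ ω, ∫⁻ x, k x * lowerMass (κ ω) (η ω) x r ∂κ ω ∂P :=
  calc ∫⁻ ω, ∫⁻ x, k x * upperMass (κ ω) (η ω) x r ∂κ ω ∂P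
      = ∫⁻ ω, ∫⁻ ξ, k ξ * lowerMass (η ω) (κ ω) ξ r ∂η ω ∂P :=
        lintegral_mul_upperMass ν hθ hκ hη hk hk0 hk_top r
    _ ≤ ∫⁻ ω, ∫⁻ ξ, k ξ * upperMass (η ω) (κ ω) ξ r ∂η ω ∂P := by
        gcongr with ω ξ
        exact lowerMass_le_upperMass (η ω) (κ ω) ξ r
    _ = ∫⁻ ω, ∫⁻ x, k x * lowerMass (κ ω) (η ω) x r ∂κ ω ∂P :=
        lintegral_mul_upperMass ν hθ hη hκ hk hk0 hk_top r

theorem ae_upperMass_le_of_radius [SigmaFinite (P.bind κ)] (r : ℝ) :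
    ∀ᵐ ω ∂P, ∀ᵐ x ∂κ ω, upperMass (κ ω) (η ω) x r ≤ lowerMass (κ ω) (η ω) x r := by
  let ν : Measure E := Measure.addHaar
  obtain ⟨k, hk_pos, hk, hkν, hkκ⟩ := exists_pos_lintegral_ne_top ν (P.bind κ)
  have hk0 (x : E) : (k x : ℝ≥0∞) ≠ 0 := ENNReal.coe_ne_zero.2 (hk_pos x).ne'
  replace hk : Measurable fun x => (k x : ℝ≥0∞) := hk.coe_nnreal_ennreal
  rw [Measure.lintegral_bind κ.aemeasurable hk.aemeasurable] at hkκ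
  have hkν0 : ∫⁻ t, k t ∂ν ≠ 0 := by
    rw [← pos_iff_ne_zero, lintegral_pos_iff_support hk, support_eq_univ hk0]
    exact isOpen_univ.measure_pos ν univ_nonempty
  have hupper : Measurable fun p : Ω × E => k p.2 * upperMass (κ p.1) (η p.1) p.2 r :=
    (hk.comp measurable_snd).mul (measurable_upperMass r)
  have hlower : Measurable fun p : Ω × E => k p.2 * lowerMass (κ p.1) (η p.1) p.2 r :=
    (hk.comp measurable_snd).mul (measurable_lowerMass r)
  have hle := lintegral_mul_upperMass_le ν hθ hκ hη hk hkν0 hkν r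
  have hfin : ∫⁻ ω, ∫⁻ x, k x * lowerMass (κ ω) (η ω) x r ∂κ ω ∂P ≠ ∞ :=
    ne_top_of_le_ne_top hkκ
      (lintegral_mono fun ω => lintegral_mono fun x => mul_le_of_le_one_right' (min_le_left _ _))
  rw [← Measure.lintegral_compProd hlower] at hle hfin
  rw [← Measure.lintegral_compProd hupper] at hle
  have hae := ae_eq_of_ae_le_of_lintegral_le
    (.of_forall fun p => by gcongr; exact lowerMass_le_upperMass (κ p.1) (η p.1) p.2 r)
    hfin hupper.aemeasurable hle
  filter_upwards [Measure.ae_ae_of_ae_compProd hae] with ω hω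
  filter_upwards [hω] with x hx
  exact ((ENNReal.mul_right_inj (hk0 x) ENNReal.coe_ne_top).1 hx).ge

theorem ae_upperMass_le [SigmaFinite (P.bind κ)] :
    ∀ᵐ ω ∂P, ∀ᵐ x ∂κ ω, ∀ r, upperMass (κ ω) (η ω) x r ≤ lowerMass (κ ω) (η ω) x r := by
  have hae : ∀ᵐ ω ∂P, ∀ q : ℚ, ∀ᵐ x ∂κ ω,
      upperMass (κ ω) (η ω) x q ≤ lowerMass (κ ω) (η ω) x q :=
    ae_all_iff.2 fun q => ae_upperMass_le_of_radius hθ hκ hη q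
  filter_upwards [hae] with ω hω
  filter_upwards [ae_all_iff.2 hω] with x hx r
  exact upperMass_le_lowerMass_of_rat hx r

end BalancedMass

end StableTransport

open StableTransport in
theorem theorem3p18_general {d : ℕ} {Ω : Type*} [MeasurableSpace Ω]
    (θ : Space d → Ω → Ω) (hθ : IsMeasurableFlow θ) (P : Measure Ω) [SFinite P]
    (Φ Ψ : Ω → Measure (Space d))
    (hΦ : IsStationaryRandomMeasure θ P Φ) (hΨ : IsStationaryRandomMeasure θ P Ψ)
    (lamΦ : ℝ≥0∞) (hlamΦ : HasIntensity P Φ lamΦ) (hΦfin : lamΦ < ∞)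
    (hA : ∀ᵐ ω ∂P, UniquenessAssumption (Φ ω) (Ψ ω)) :
    ∀ᵐ ω ∂P, ∀ f g : Space d → Space d → ℝ≥0,
      IsStableConstrained (Φ ω) (Ψ ω) f → IsStableConstrained (Φ ω) (Ψ ω) g →
      ∀ᵐ p ∂((Φ ω).prod (Ψ ω)), f p.1 p.2 = g p.1 p.2 := by
  let κ : ProbabilityTheory.Kernel Ω (Space d) := ⟨Φ, hΦ.measurable⟩
  let η : ProbabilityTheory.Kernel Ω (Space d) := ⟨Ψ, hΨ.measurable⟩
  have : ∀ ω, IsLocallyFiniteMeasure (κ ω) := hΦ.locallyFinite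
  have : ∀ ω, IsLocallyFiniteMeasure (η ω) := hΨ.locallyFinite
  have hflow (t : Space d) : MeasurePreserving (θ t) P P :=
    ⟨hθ.measurable.comp measurable_prodMk_right, hΦ.stationary t⟩
  have : SigmaFinite (P.bind κ) := by
    lift lamΦ to ℝ≥0 using hΦfin.ne
    exact hlamΦ.bind_eq hΦ.measurable ▸ inferInstanceAs (SigmaFinite (lamΦ • volume))
  filter_upwards [hA, ae_upperMass_le (κ := κ) (η := η) hflow hΦ.flowAdapted hΨ.flowAdapted]
    with ω hAω hmass f g hf hg
  exact hf.ae_eq hg hAω hmass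

open StableTransport in
theorem theorem3p18 {d : ℕ} {Ω : Type*} [MeasurableSpace Ω]
    (θ : Space d → Ω → Ω) (hθ : IsMeasurableFlow θ)
    (P : Measure Ω) [IsProbabilityMeasure P]
    (Φ Ψ : Ω → Measure (Space d))
    (hΦ : IsStationaryRandomMeasure θ P Φ) (hΨ : IsStationaryRandomMeasure θ P Ψ)
    (lamΦ lamΨ : ℝ≥0∞)
    (hlamΦ : HasIntensity P Φ lamΦ) (hlamΨ : HasIntensity P Ψ lamΨ)
    (hΦpos : 0 < lamΦ) (hΦfin : lamΦ < ∞) (hΨpos : 0 < lamΨ) (hΨfin : lamΨ < ∞)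
    (hA : ∀ᵐ ω ∂P, UniquenessAssumption (Φ ω) (Ψ ω)) :
    ∀ᵐ ω ∂P, ∀ f g : Space d → Space d → ℝ≥0,
      IsStableConstrained (Φ ω) (Ψ ω) f → IsStableConstrained (Φ ω) (Ψ ω) g →
      ∀ᵐ p ∂((Φ ω).prod (Ψ ω)), f p.1 p.2 = g p.1 p.2 := by
  exact theorem3p18_general θ hθ P Φ Ψ hΦ hΨ lamΦ hlamΦ hΦfin hA
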